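/- **Text and arrays.** Let $T$ be a text of length $n\ge 1$ over a linearly ordered alphabet whose last character is a sentinel smaller than every other character of $T$. Positions and array indices are numbered $0,\dots,n-1$, and $T[i..]$ is the suffix starting at $i$. The suffix array $\mathsf{SA}$ lists the starting positions of the suffixes in lexicographic order. $\mathsf{LCP}[0]=0$, and $\mathsf{LCP}[k]$ for $k\ge1$ is the length of the longest common prefix of $T[\mathsf{SA}[k]..]$ and $T[\mathsf{SA}[k-1]..]$. The permuted LCP array is given by $\mathsf{PLCP}[\mathsf{SA}[k]]=\mathsf{LCP}[k]$. $\mathsf{BWT}[k]=T[\mathsf{SA}[k]-1]$ if $\mathsf{SA}[k]\neq0$, and $\mathsf{BWT}[k]=T[n-1]$ otherwise. Let $r$ be the number of runs (maximal blocks of equal characters) of $\mathsf{BWT}$. **Peaks.** Let $\theta\ge2$ be an integer (the minimum length of a referencing factor), $P$ an array of nonnegative integers indexed by positions, $F$ a set of referencing factors (a factor $(d,\ell)$ covers the positions $d,\dots,d+\ell-1$), and $S$ a set of positions. A position $d$ is a *peak* if $P[d]\ge\theta$ and ($d=0$, or $P[d-1]<P[d]$, or a factor in $F$ ends at $d-1$).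 A peak $d$ is *interesting* with respect to $S$ if there is no $j\in S$ with $j<d<j+P[j]$ and $P[j]\ge P[d]$. An interesting peak $d$ is *maximal* with respect to $S$ if no $j\in S$ with $d<j<d+P[d]$ is an interesting peak with respect to $S$. **Algorithm.** Start with $P=\mathsf{PLCP}$, $F=\emptyset$, an empty list $L$, $s=0$ and $d=0$, and repeat the following while $d<n$, where peaks are considered with respect to $S=\{s,\dots,n-1\}$: 1. If $d$ is not an interesting peak, increment $d$. If $d$ is an interesting peak that is not maximal, insert $d$ into $L$ and increment $d$. 2. If $d$ is a maximal peak, then (a) add the factor $(d,P[d])$ to $F$; replace $P[j]$ by $\min(P[j],d-j)$ for every $j\in L\cap[d-P[d],d)$; remove from $L$ all elements that are no longer interesting peaks with respect to $L$; (b) while $L$ contains maximal peaks with respect to $L$, let $j$ be the rightmost one and $\ell=P[j]$; add the factor $(j,\ell)$ to $F$; replace $P[i]$ by $\min(P[i],j-i)$ for every $i\in L\cap[j-\ell,j)$ and by $0$ for every $i\in L\cap[j,j+\ell)$; remove from $L$ all elements that are no longer interesting peaks with respect to $L$; (c) set both $s$ and $d$ to $d+P[d]$. **Lemma.** There is an absolute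 constant $C>0$ such that, for every such text $T$ and every integer $\theta\ge2$, at any time during the run of the algorithm, $$|L|\le C\cdot\min\left(\sqrt{n\log_2 n},\; r\right).$$ That is, $|L|=O(\min(\sqrt{n\lg n},r))$. -/

import Mathlib

universe u

namespace Plcpcomp

/-! Text positions and array indices are numbered from `0`; a text of length `n` has the
positions `0, …, n - 1`. -/

/-! ### Text data structures -/

section Text

variable {α : Type u} [LinearOrder α]

/-- The text ends with a sentinel that is smaller than every other character of the text. -/
def EndsWithSentinel (T : List α) : Prop :=
  ∃ (W : List α) (e : α), T = W ++ [e] ∧ ∀ a ∈ W, e < a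

/-- Length of the longest common prefix of two strings. -/
def lcp : List α → List α → ℕ
  | a :: u, b :: v => if a = b then lcp u v + 1 else 0
  | _, _ => 0

/-- The suffix of `T` starting at position `i`. -/
def suffix (T : List α) (i : ℕ) : List α := T.drop i

/-- The suffix array: the permutation that lists the starting positions of the suffixes of `T`
in lexicographic order of the suffixes. -/
def SA (T : List α) : Equiv.Perm (Fin T.length) :=
  Tuple.sort (fun i : Fin T.length => suffix T i)

/-- The inverse suffix array. -/
def ISA (T : List α) : Equiv.Perm (Fin T.length) := (SA T).symm

/-- The LCP array. Its first entry is `0`; every other entry is the length of the longest common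
prefix of a suffix and its lexicographic predecessor. -/
def LCP (T : List α) (k : Fin T.length) : ℕ :=
  if k.val = 0 then 0
  else lcp (suffix T (SA T k)) (suffix T (SA T ⟨k.val - 1, (Nat.sub_le _ _).trans_lt k.isLt⟩))

/-- The permuted LCP array: the LCP array in text order (and `0` outside of the text). -/
def PLCP (T : List α) (i : ℕ) : ℕ :=
  if h : i < T.length then LCP T (ISA T ⟨i, h⟩) else 0

/-- The Burrows-Wheeler transform: the character that precedes the `k`-th smallest suffix, and
the last character of `T` for the suffix that is the whole text. -/
def BWT (T : List α) (k : Fin T.length) : α :=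
  if (SA T k).val = 0 then T[T.length - 1]'(Nat.sub_lt (Nat.zero_lt_of_lt k.isLt) Nat.one_pos)
  else T[(SA T k).val - 1]'((Nat.sub_le _ _).trans_lt (SA T k).isLt)

/-- The number of runs (maximal blocks of equal characters) of the BWT, counted through the
indices at which a run begins. -/
def bwtRuns (T : List α) : ℕ :=
  (Finset.univ.filter (fun k : Fin T.length =>
    k.val = 0 ∨ BWT T k ≠ BWT T ⟨k.val - 1, (Nat.sub_le _ _).trans_lt k.isLt⟩)).card

end Text

/-! ### Peaks

`θ` is the minimum length of a referencing factor, `P` is the current (rewritable) PLCP array, `F`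
is the set of referencing factors created so far, where `(d, ℓ)` is the factor that covers the
positions `d, …, d + ℓ - 1`, and `S` is the set of text positions that are taken into account. -/

/-- `d` is a peak. -/
def IsPeak (θ : ℕ) (P : ℕ → ℕ) (F : Finset (ℕ × ℕ)) (d : ℕ) : Prop :=
  θ ≤ P d ∧ (d = 0 ∨ P (d - 1) < P d ∨ ∃ f ∈ F, f.1 + f.2 = d)

/-- `d` is an interesting peak. -/
def IsInteresting (θ : ℕ) (P : ℕ → ℕ) (F : Finset (ℕ × ℕ)) (S : Finset ℕ) (d : ℕ) : Prop :=
  IsPeak θ P F d ∧ ¬ ∃ j ∈ S, (j < d ∧ d < j + P j) ∧ P d ≤ P j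

/-- `d` is a maximal peak. -/
def IsMaximal (θ : ℕ) (P : ℕ → ℕ) (F : Finset (ℕ × ℕ)) (S : Finset ℕ) (d : ℕ) : Prop :=
  IsInteresting θ P F S d ∧
    ¬ ∃ j ∈ S, (d < j ∧ j < d + P d) ∧ IsInteresting θ P F S j

/-! ### The compression algorithm -/

/-- Rule (D) for a factor `(d, ℓ)`, applied to the positions in `L`:
`P[j] ← min (P[j], d - j)` for `j ∈ [d - ℓ, d)`. -/
def ruleD (L : Finset ℕ) (d l : ℕ) (P : ℕ → ℕ) : ℕ → ℕ := fun j =>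
  if j ∈ L ∧ d ≤ j + l ∧ j < d then min (P j) (d - j) else P j

/-- Rule (R) for a factor `(d, ℓ)`, applied to the positions in `L`:
`P[j] ← 0` for `j ∈ [d, d + ℓ)`. -/
def ruleR (L : Finset ℕ) (d l : ℕ) (P : ℕ → ℕ) : ℕ → ℕ := fun j =>
  if j ∈ L ∧ d ≤ j ∧ j < d + l then 0 else P j

open Classical in
/-- The elements of `L` that are (still) interesting peaks, among the positions in `L`. -/
noncomputable def keepInteresting (θ : ℕ) (P : ℕ → ℕ) (F : Finset (ℕ × ℕ)) (L : Finset ℕ) :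
    Finset ℕ :=
  L.filter (fun d => IsInteresting θ P F L d)

/-- The algorithm either scans the text for a maximal peak, or, after it has found one, processes
the list `L`. -/
inductive Phase
  | scan
  | process

/-- A state of the algorithm: the phase, the scan position `pos`, the beginning `start` of the
part of the text that follows the last factor found by the scan (all of this part is still to be
factorized), the current PLCP values `P`, the referencing factors `F` created so far, and the list
`L` of interesting peaks. -/
structure State where
  phase : Phase
  pos : ℕ
  start : ℕ
  P : ℕ → ℕ
  F : Finset (ℕ × ℕ)
  L : Finset ℕ

/-- The initial state. -/
def init {α : Type u} [LinearOrder α] (T : List α) : State where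
  phase := Phase.scan
  pos := 0
  start := 0
  P := PLCP T
  F := ∅
  L := ∅

/-- The positions of the part of the text that the scan is working on, which is treated as a text
of its own. -/
def State.rest (n : ℕ) (s : State) : Finset ℕ := Finset.Ico s.start n

/-- One step of the algorithm on a text of length `n`. -/
inductive Step (n θ : ℕ) : State → State → Prop
  /-- The scan passes a position that is not an interesting peak. -/
  | skip (s : State) (hs : s.phase = Phase.scan) (hn : s.pos < n)
      (h : ¬ IsInteresting θ s.P s.F (s.rest n) s.pos) :
      Step n θ s { s with pos := s.pos + 1 }
  /-- The scan passes an interesting peak that is not maximal and inserts it into `L`. -/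
  | insert (s : State) (hs : s.phase = Phase.scan) (hn : s.pos < n)
      (h : IsInteresting θ s.P s.F (s.rest n) s.pos)
      (hm : ¬ IsMaximal θ s.P s.F (s.rest n) s.pos) :
      Step n θ s { s with pos := s.pos + 1, L := Insert.insert s.pos s.L }
  /-- The scan finds a maximal peak: a referencing factor is created there, Rule (D) is applied to
  `L`, and the elements that are no longer interesting peaks are removed from `L`. -/
  | factor (s : State) (hs : s.phase = Phase.scan) (hn : s.pos < n)
      (hm : IsMaximal θ s.P s.F (s.rest n) s.pos)
      (P' : ℕ → ℕ) (hP : P' = ruleD s.L s.pos (s.P s.pos) s.P)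
      (F' : Finset (ℕ × ℕ)) (hF : F' = Insert.insert (s.pos, s.P s.pos) s.F) :
      Step n θ s { s with
        phase := Phase.process, P := P', F := F', L := keepInteresting θ P' F' s.L }
  /-- While `L` contains maximal peaks, a referencing factor is created at the rightmost one, `j`;
  Rules (D) and (R) are applied to `L`, and the elements that are no longer interesting peaks are
  removed from `L`. -/
  | loop (s : State) (hs : s.phase = Phase.process) (j : ℕ) (hj : j ∈ s.L)
      (hm : IsMaximal θ s.P s.F s.L j)
      (hright : ∀ k ∈ s.L, IsMaximal θ s.P s.F s.L k → k ≤ j)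
      (P' : ℕ → ℕ) (hP : P' = ruleR s.L j (s.P j) (ruleD s.L j (s.P j) s.P))
      (F' : Finset (ℕ × ℕ)) (hF : F' = Insert.insert (j, s.P j) s.F) :
      Step n θ s { s with P := P', F := F', L := keepInteresting θ P' F' s.L }
  /-- When `L` contains no maximal peak any more, the scan is resumed behind the factor that it
  has found last. -/
  | resume (s : State) (hs : s.phase = Phase.process)
      (hm : ∀ k ∈ s.L, ¬ IsMaximal θ s.P s.F s.L k) :
      Step n θ s { s with
        phase := Phase.scan, pos := s.pos + s.P s.pos, start := s.pos + s.P s.pos }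

/-- The states that occur when the algorithm is run on the text `T` with threshold `θ`. -/
def Reachable {α : Type u} [LinearOrder α] (T : List α) (θ : ℕ) (s : State) : Prop :=
  Relation.ReflTransGen (Step T.length θ) (init T) s

end Plcpcomp

/-! While the scan has met no maximal peak since the last restart, the original PLCP values strictly
increase along `L`. Indeed, a non-maximal interesting peak reaches over a later interesting peak,
which must have a larger value, since otherwise it would not be interesting; iterating this step
arrives at every later element of `L`. Processing only removes elements and ends with an empty list,
so at all times `L` is a set with distinct PLCP values (`Reachable.isChain`).

Apart from at most one element, each `d ∈ L` satisfies `PLCP[d-1] < PLCP[d]`, hence is irreducible: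
its suffix and the lexicographic predecessor have different left characters
(`isIrreducible_of_PLCP_lt`). Irreducible entries begin BWT runs, which gives the bound by `r`.
Irreducible LCP values sum to at most `2 n log n` (`sum_LCP_isIrreducible_le`), whereas `m` distinct
positive integers sum to at least `m² / 2`, which gives the bound by `√(n log n)`. -/

namespace Plcpcomp

/-! ### Suffixes, irreducible LCP entries and BWT runs. -/

section Suffix

variable {α : Type u}

theorem suffix_eq_cons {T : List α} {i : ℕ} (hi : i < T.length) :
    suffix T i = T[i] :: suffix T (i + 1) := by
  simp [suffix]

theorem suffix_injOn {T : List α} {i j : ℕ} (hi : i < T.length) (hj : j < T.length)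
    (h : suffix T i = suffix T j) : i = j := by
  have := congrArg List.length h
  simp only [suffix, List.length_drop] at this
  omega

end Suffix

section Text

variable {α : Type u} [LinearOrder α]

theorem cons_le_cons_iff {a b : α} {u v : List α} :
    a :: u ≤ b :: v ↔ a < b ∨ a = b ∧ u ≤ v := by
  rw [← not_lt, List.cons_lt_cons_iff, ← not_lt (a := v) (b := u)]
  rcases lt_trichotomy a b with h | h | h
  · simp [h, h.ne', h.not_gt]
  · simp [h]
  · simp [h, h.ne', h.not_gt]

theorem lcp_le_lcp_of_le_of_le {u v w : List α} (huv : u ≤ v) (hvw : v ≤ w) :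
    lcp w u ≤ lcp w v := by
  induction w generalizing u v with
  | nil => simp [lcp]
  | cons a w ih =>
    cases u with
    | nil => simp [lcp]
    | cons b u =>
      by_cases hab : a = b
      · subst hab
        cases v with
        | nil => exact absurd huv (by simp)
        | cons c v =>
          rw [cons_le_cons_iff] at huv hvw
          have hc : a = c := le_antisymm
            (huv.elim le_of_lt fun h => h.1.le) (hvw.elim le_of_lt fun h => h.1.le)
          subst hc
          simp only [lt_irrefl, false_or, true_and] at huv hvw
          simpa [lcp] using ih huv hvw
      · simp [lcp, hab]

theorem getElem?_eq_of_lt_lcp {u v : List α} {t : ℕ} (ht : t < lcp u v) :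
    t < u.length ∧ t < v.length ∧ u[t]? = v[t]? := by
  induction u generalizing v t with
  | nil => simp [lcp] at ht
  | cons a u ih =>
    cases v with
    | nil => simp [lcp] at ht
    | cons b v =>
      by_cases hab : a = b
      · simp only [lcp, hab, if_true] at ht
        cases t with
        | zero => simp [hab]
        | succ t => simpa using ih (by omega : t < lcp u v)
      · simp [lcp, hab] at ht

theorem getElem?_add_eq_of_lt_lcp_suffix {T : List α} {i j t : ℕ}
    (ht : t < lcp (suffix T i) (suffix T j)) :
    i + t < T.length ∧ j + t < T.length ∧ T[i + t]? = T[j + t]? := by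
  have h := getElem?_eq_of_lt_lcp ht
  simp only [suffix, List.length_drop, List.getElem?_drop] at h
  exact ⟨by omega, by omega, h.2.2⟩

theorem monotone_suffix_SA (T : List α) : Monotone fun k => suffix T (SA T k) :=
  Tuple.monotone_sort (fun i : Fin T.length => suffix T i)

/-- The index that precedes `k` in an array. -/
def predIndex {n : ℕ} (k : Fin n) : Fin n := ⟨k.val - 1, (Nat.sub_le _ _).trans_lt k.isLt⟩

theorem predIndex_injOn {n : ℕ} {k l : Fin n} (hk : k.val ≠ 0) (hl : l.val ≠ 0)
    (h : predIndex k = predIndex l) : k = l := by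
  have := congrArg Fin.val h
  simp only [predIndex] at this
  exact Fin.ext (by omega)

theorem LCP_eq {T : List α} {k : Fin T.length} (hk : k.val ≠ 0) :
    LCP T k = lcp (suffix T (SA T k)) (suffix T (SA T (predIndex k))) := by
  simp [LCP, hk, predIndex]

/-- Among all smaller suffixes, the lexicographic predecessor is closest in the order, and closeness
can only lengthen the common prefix. -/
theorem lcp_suffix_le_PLCP {T : List α} {i j : ℕ} (hi : i < T.length) (hj : j < T.length)
    (hne : j ≠ i) (hle : suffix T j ≤ suffix T i) :
    lcp (suffix T i) (suffix T j) ≤ PLCP T i := by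
  obtain ⟨k, hk⟩ := (SA T).surjective ⟨i, hi⟩
  obtain ⟨l, hl⟩ := (SA T).surjective ⟨j, hj⟩
  have hlk : l < k := by
    by_contra! h
    have := monotone_suffix_SA T h
    simp only [hk, hl] at this
    exact hne (suffix_injOn hj hi (le_antisymm hle this))
  have hk0 : k.val ≠ 0 := by have := Fin.lt_def.1 hlk; omega
  have hI : ISA T ⟨i, hi⟩ = k := by rw [ISA, Equiv.symm_apply_eq, hk]
  have h1 : l ≤ predIndex k := by
    have := Fin.lt_def.1 hlk
    simp only [Fin.le_def, predIndex]; omega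
  have h2 : predIndex k ≤ k := by simp [Fin.le_def, predIndex]
  have h3 := monotone_suffix_SA T h1
  have h4 := monotone_suffix_SA T h2
  simp only [hk, hl] at h3 h4
  simp only [PLCP, hi, dif_pos, hI, LCP_eq hk0, hk]
  exact lcp_le_lcp_of_le_of_le h3 h4

/-- The entry `k` of the suffix array is irreducible: the suffix and its lexicographic
predecessor are not preceded by the same character. -/
def IsIrreducible (T : List α) (k : Fin T.length) : Prop :=
  k.val ≠ 0 ∧ ((SA T k).val = 0 ∨ (SA T (predIndex k)).val = 0 ∨
    T[(SA T k).val - 1]? ≠ T[(SA T (predIndex k)).val - 1]?)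

/-- If the suffix at `d + 1` and its predecessor were preceded by the same character, prepending it
would preserve their order and lengthen the match by one, so that `PLCP[d] ≥ PLCP[d+1] + 1`. -/
theorem isIrreducible_of_PLCP_lt {T : List α} {d : ℕ} (hd : d + 1 < T.length)
    (h : PLCP T d < PLCP T (d + 1)) : IsIrreducible T (ISA T ⟨d + 1, hd⟩) := by
  set k := ISA T ⟨d + 1, hd⟩ with hk
  have hSA : SA T k = ⟨d + 1, hd⟩ := by simp [hk, ISA]
  have hP : PLCP T (d + 1) = LCP T k := by simp [PLCP, hd, hk]
  have hk0 : k.val ≠ 0 := by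
    intro h0
    simp [hP, LCP, h0] at h
  refine ⟨hk0, ?_⟩
  by_contra! hcon
  obtain ⟨-, he0, hT⟩ := hcon
  rw [hP, LCP_eq hk0] at h
  have hle : suffix T (SA T (predIndex k)) ≤ suffix T (SA T k) :=
    monotone_suffix_SA T (by simp [Fin.le_def, predIndex])
  have hne : (SA T (predIndex k)).val ≠ (SA T k).val := by
    intro h'
    have := congrArg Fin.val ((SA T).injective (Fin.ext h'))
    simp only [predIndex] at this
    omega
  have hen := (SA T (predIndex k)).isLt
  obtain ⟨e, he⟩ := Nat.exists_eq_succ_of_ne_zero he0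
  simp only [he, hSA, Nat.succ_eq_add_one, Nat.add_sub_cancel] at *
  have hd' : d < T.length := by omega
  have he' : e < T.length := by omega
  rw [List.getElem?_eq_getElem hd', List.getElem?_eq_getElem he', Option.some_inj] at hT
  have key := lcp_suffix_le_PLCP (T := T) (i := d) (j := e) hd' he' (by omega) (by
    rw [suffix_eq_cons hd', suffix_eq_cons he', cons_le_cons_iff]
    exact Or.inr ⟨hT.symm, hle⟩)
  rw [suffix_eq_cons hd', suffix_eq_cons he', lcp, if_pos hT] at key
  omega

theorem EndsWithSentinel.length_pos {T : List α} (hT : EndsWithSentinel T) : 0 < T.length := by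
  obtain ⟨W, e, rfl, -⟩ := hT
  simp

theorem EndsWithSentinel.getElem_last_lt {T : List α} (hT : EndsWithSentinel T) {i : ℕ}
    (hi : i + 1 < T.length) : T[T.length - 1]'(by omega) < T[i] := by
  obtain ⟨W, e, rfl, h⟩ := hT
  simp only [List.length_append, List.length_singleton] at hi
  have hi' : i < W.length := by omega
  simpa [List.getElem_append_left hi'] using h _ (List.getElem_mem hi')

/-- The sentinel settles the wrap-around at text position `0`: it differs from every other left
character. -/
theorem IsIrreducible.BWT_ne {T : List α} (hT : EndsWithSentinel T) {k : Fin T.length}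
    (hk : IsIrreducible T k) : BWT T k ≠ BWT T (predIndex k) := by
  obtain ⟨hk0, h⟩ := hk
  have hne : (SA T (predIndex k)).val ≠ (SA T k).val := by
    intro h'
    have := congrArg Fin.val ((SA T).injective (Fin.ext h'))
    simp only [predIndex] at this
    omega
  have h1 := (SA T k).isLt
  have h2 := (SA T (predIndex k)).isLt
  unfold BWT
  by_cases ha : (SA T k).val = 0 <;> by_cases hb : (SA T (predIndex k)).val = 0
  · omega
  · rw [if_pos ha, if_neg hb]
    exact (hT.getElem_last_lt (by omega)).ne
  · rw [if_neg ha, if_pos hb]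
    exact (hT.getElem_last_lt (by omega)).ne'
  · rw [if_neg ha, if_neg hb]
    intro h'
    rw [List.getElem?_eq_getElem (by omega), List.getElem?_eq_getElem (by omega), h'] at h
    simp_all

open Classical in
theorem card_isIrreducible_le_bwtRuns {T : List α} (hT : EndsWithSentinel T) :
    (Finset.univ.filter (IsIrreducible T)).card + 1 ≤ bwtRuns T := by
  have hpos := hT.length_pos
  -- Index `0` begins a run but is never irreducible. This spare run later pays for the exceptional
  -- element of a chain.
  rw [← Finset.card_insert_of_notMem (a := (⟨0, hpos⟩ : Fin T.length))
    (by simp [IsIrreducible])]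
  unfold bwtRuns
  refine Finset.card_le_card fun k hk => ?_
  simp only [Finset.mem_insert, Finset.mem_filter, Finset.mem_univ, true_and] at hk ⊢
  rcases hk with rfl | hk
  · exact Or.inl rfl
  · exact Or.inr (hk.BWT_ne hT)

end Text

/-! ### The sum of the irreducible LCP values. -/

section IrreducibleSum

theorem two_pow_card_halving_mul_le {c : ℕ → ℕ} (hc : Antitone c) (m : ℕ) :
    2 ^ ((Finset.range m).filter fun h => 2 * c (h + 1) ≤ c h).card * c m ≤ c 0 := by
  induction m with
  | zero => simp
  | succ m ih =>
    rw [Finset.range_add_one, Finset.filter_insert]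
    refine le_trans ?_ ih
    split_ifs with h
    · rw [Finset.card_insert_of_notMem (by simp), pow_succ, mul_assoc]
      exact Nat.mul_le_mul_left _ h
    · exact Nat.mul_le_mul_left _ (hc (Nat.le_succ m))

theorem card_halving_le_log {c : ℕ → ℕ} (hc : Antitone c) {m n : ℕ} (hm : 0 < c m)
    (hn : c 0 ≤ n) :
    ((Finset.range m).filter fun h => 2 * c (h + 1) ≤ c h).card ≤ Nat.log 2 n :=
  Nat.le_log_of_pow_le one_lt_two <|
    (Nat.le_mul_of_pos_right _ hm).trans ((two_pow_card_halving_mul_le hc m).trans hn)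

variable {α : Type u}

/-- The positions `p` and `q` are equal, or the `h + 1` characters that end at `p` are those that
end at `q`. -/
def SameContext (T : List α) (h p q : ℕ) : Prop :=
  p = q ∨ h ≤ p ∧ h ≤ q ∧ ∀ t ≤ h, T[p - t]? = T[q - t]?

theorem SameContext.symm {T : List α} {h p q : ℕ} (hpq : SameContext T h p q) :
    SameContext T h q p := by
  rcases hpq with rfl | ⟨hp, hq, H⟩
  · exact Or.inl rfl
  · exact Or.inr ⟨hq, hp, fun t ht => (H t ht).symm⟩

theorem SameContext.trans {T : List α} {h p q r : ℕ} (hpq : SameContext T h p q)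
    (hqr : SameContext T h q r) : SameContext T h p r := by
  rcases hpq with rfl | ⟨hp, hq, H⟩
  · exact hqr
  · rcases hqr with rfl | ⟨-, hr, H'⟩
    · exact Or.inr ⟨hp, hq, H⟩
    · exact Or.inr ⟨hp, hr, fun t ht => (H t ht).trans (H' t ht)⟩

theorem SameContext.anti {T : List α} {h h' p q : ℕ} (hh : h' ≤ h) (hpq : SameContext T h p q) :
    SameContext T h' p q :=
  hpq.imp_right fun ⟨hp, hq, H⟩ => ⟨hh.trans hp, hh.trans hq, fun t ht => H t (ht.trans hh)⟩

open Classical in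
/-- The positions of the text with the same context of length `h + 1` as `p`. -/
noncomputable def contextClass (T : List α) (p h : ℕ) : Finset ℕ :=
  (Finset.range T.length).filter (SameContext T h p)

theorem mem_contextClass {T : List α} {p h q : ℕ} :
    q ∈ contextClass T p h ↔ q < T.length ∧ SameContext T h p q := by
  simp [contextClass]

theorem contextClass_anti (T : List α) (p : ℕ) : Antitone (contextClass T p) :=
  fun _ _ hh _ hq => mem_contextClass.2
    ⟨(mem_contextClass.1 hq).1, (mem_contextClass.1 hq).2.anti hh⟩

/-- When one class splits so as to separate `p` from `q`, their new classes are disjoint parts of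
it, so the smaller one has at most half its size. -/
theorem two_mul_card_contextClass_le {T : List α} {p q h : ℕ} (h1 : SameContext T h p q)
    (h2 : ¬ SameContext T (h + 1) p q) :
    2 * (contextClass T p (h + 1)).card ≤ (contextClass T p h).card ∨
      2 * (contextClass T q (h + 1)).card ≤ (contextClass T q h).card := by
  have heq : contextClass T q h = contextClass T p h := by
    ext x
    simp only [mem_contextClass]
    exact and_congr_right fun _ => ⟨h1.trans, h1.symm.trans⟩
  have hdisj : Disjoint (contextClass T p (h + 1)) (contextClass T q (h + 1)) :=
    Finset.disjoint_left.2 fun x hx hx' =>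
      h2 ((mem_contextClass.1 hx).2.trans (mem_contextClass.1 hx').2.symm)
  have hp := contextClass_anti T p (Nat.le_succ h)
  have hq := contextClass_anti T q (Nat.le_succ h)
  rw [heq] at hq ⊢
  have := Finset.card_le_card (Finset.union_subset hp hq)
  rw [Finset.card_union_of_disjoint hdisj] at this
  omega

/-- The pairs `(p, h)` such that the class of `p` at least halves when contexts of length `h + 1`
are extended by one character. -/
noncomputable def halvingPairs (T : List α) : Finset ((_ : ℕ) × ℕ) :=
  (Finset.range T.length).sigma fun p => (Finset.range T.length).filter fun h =>
    2 * (contextClass T p (h + 1)).card ≤ (contextClass T p h).card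

theorem card_halvingPairs_le (T : List α) :
    (halvingPairs T).card ≤ T.length * Nat.log 2 T.length := by
  rw [halvingPairs, Finset.card_sigma]
  refine (Finset.sum_le_card_nsmul _ _ (Nat.log 2 T.length) fun p hp => ?_).trans (by simp)
  refine card_halving_le_log (c := fun h => (contextClass T p h).card)
    (fun _ _ hh => Finset.card_le_card (contextClass_anti T p hh)) ?_ ?_
  -- The alternative `p = q` in `SameContext` keeps `p` in its own class even when the context would
  -- extend beyond the start of the text.
  · exact Finset.card_pos.2 ⟨p, mem_contextClass.2 ⟨Finset.mem_range.1 hp, Or.inl rfl⟩⟩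
  · exact (Finset.card_le_card fun q hq => Finset.mem_range.2 (mem_contextClass.1 hq).1).trans
      (Finset.card_range _).le

variable [LinearOrder α]

/-- At offset `h` inside the common prefix, the two contexts agree back to the beginnings of the
suffixes; irreducibility makes them differ one character earlier, so a class halves exactly there.
-/
theorem IsIrreducible.halving {T : List α} {k : Fin T.length} (hk : IsIrreducible T k) {h : ℕ}
    (hh : h < LCP T k) :
    (⟨(SA T k).val + h, h⟩ : (_ : ℕ) × ℕ) ∈ halvingPairs T ∨
      (⟨(SA T (predIndex k)).val + h, h⟩ : (_ : ℕ) × ℕ) ∈ halvingPairs T := by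
  obtain ⟨hk0, hk⟩ := hk
  have hne : (SA T (predIndex k)).val ≠ (SA T k).val := by
    intro h'
    have := congrArg Fin.val ((SA T).injective (Fin.ext h'))
    simp only [predIndex] at this
    omega
  rw [LCP_eq hk0] at hh
  set i := (SA T k).val
  set j := (SA T (predIndex k)).val
  have hT : ∀ t ≤ h, i + t < T.length ∧ j + t < T.length ∧ T[i + t]? = T[j + t]? := fun t ht =>
    getElem?_add_eq_of_lt_lcp_suffix (ht.trans_lt hh)
  have h1 : SameContext T h (i + h) (j + h) := by
    refine Or.inr ⟨by omega, by omega, fun t ht => ?_⟩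
    rw [Nat.add_sub_assoc ht, Nat.add_sub_assoc ht]
    exact (hT (h - t) (by omega)).2.2
  have h2 : ¬ SameContext T (h + 1) (i + h) (j + h) := by
    rintro (heq | ⟨hi, hj, H⟩)
    · omega
    · have := H (h + 1) le_rfl
      rw [show i + h - (h + 1) = i - 1 by omega, show j + h - (h + 1) = j - 1 by omega] at this
      rcases hk with hk | hk | hk
      · omega
      · omega
      · exact hk this
  have hlt := hT h le_rfl
  simp only [halvingPairs, Finset.mem_sigma, Finset.mem_range, Finset.mem_filter]
  exact (two_mul_card_contextClass_le h1 h2).imp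
    (fun h' => ⟨hlt.1, by omega, h'⟩) (fun h' => ⟨hlt.2.1, by omega, h'⟩)

open Classical in
/-- The sum of the irreducible LCP values is `O(n log n)`. -/
theorem sum_LCP_isIrreducible_le (T : List α) :
    ∑ k ∈ Finset.univ.filter (IsIrreducible T), LCP T k ≤
      2 * (T.length * Nat.log 2 T.length) := by
  set D : Finset ((_ : Fin T.length) × ℕ) :=
    (Finset.univ.filter (IsIrreducible T)).sigma fun k => Finset.range (LCP T k) with hD
  have hcard : D.card = ∑ k ∈ Finset.univ.filter (IsIrreducible T), LCP T k := by
    simp [hD, Finset.card_sigma]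
  let f : ((_ : Fin T.length) × ℕ) → ((_ : ℕ) × ℕ) := fun x => ⟨(SA T x.1).val + x.2, x.2⟩
  let g : ((_ : Fin T.length) × ℕ) → ((_ : ℕ) × ℕ) :=
    fun x => ⟨(SA T (predIndex x.1)).val + x.2, x.2⟩
  have hmem : ∀ x ∈ D, IsIrreducible T x.1 ∧ x.2 < LCP T x.1 := fun x hx => by
    simpa [hD] using hx
  -- Each unit of LCP is charged to a halving at the suffix itself or at its predecessor. Both
  -- charges are injective, whence the factor `2`.
  rw [← hcard, ← Finset.card_filter_add_card_filter_not (s := D) (fun x => f x ∈ halvingPairs T),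
    two_mul]
  refine Nat.add_le_add (le_trans ?_ (card_halvingPairs_le T))
    (le_trans ?_ (card_halvingPairs_le T))
  · refine Finset.card_le_card_of_injOn f (fun x hx => (Finset.mem_filter.1 hx).2) ?_
    rintro ⟨k, h⟩ - ⟨l, h'⟩ - heq
    simp only [f, Sigma.mk.injEq, heq_eq_eq] at heq
    obtain ⟨heq, rfl⟩ := heq
    have : k = l := (SA T).injective (Fin.ext (by omega))
    rw [this]
  · refine Finset.card_le_card_of_injOn g (fun x hx => ?_) ?_
    · have hx := Finset.mem_filter.1 hx
      have hx' := hmem x hx.1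
      exact (hx'.1.halving hx'.2).resolve_left hx.2
    · rintro ⟨k, h⟩ hk ⟨l, h'⟩ hl heq
      have hk0 := (hmem _ (Finset.mem_filter.1 hk).1).1.1
      have hl0 := (hmem _ (Finset.mem_filter.1 hl).1).1.1
      simp only [g, Sigma.mk.injEq, heq_eq_eq] at heq
      obtain ⟨heq, rfl⟩ := heq
      have : k = l := predIndex_injOn hk0 hl0 ((SA T).injective (Fin.ext (by omega)))
      rw [this]

end IrreducibleSum

/-! ### Invariants of the algorithm. -/

section Algorithm

theorem IsInteresting.mono {θ : ℕ} {P : ℕ → ℕ} {F : Finset (ℕ × ℕ)} {S S' : Finset ℕ} {d : ℕ}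
    (hS : S' ⊆ S) (h : IsInteresting θ P F S d) : IsInteresting θ P F S' d :=
  ⟨h.1, fun ⟨j, hj, hj'⟩ => h.2 ⟨j, hS hj, hj'⟩⟩

theorem keepInteresting_subset {θ : ℕ} {P : ℕ → ℕ} {F : Finset (ℕ × ℕ)} {L : Finset ℕ} :
    keepInteresting θ P F L ⊆ L := by
  classical exact Finset.filter_subset _ _

theorem isInteresting_of_mem_keepInteresting {θ : ℕ} {P : ℕ → ℕ} {F : Finset (ℕ × ℕ)}
    {L : Finset ℕ} {d : ℕ} (hd : d ∈ keepInteresting θ P F L) :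
    IsInteresting θ P F (keepInteresting θ P F L) d := by
  classical exact ((Finset.mem_filter.1 hd).2).mono keepInteresting_subset

/-- The rightmost interesting peak of a list is maximal with respect to it. -/
theorem eq_empty_of_forall_not_isMaximal {θ : ℕ} {P : ℕ → ℕ} {F : Finset (ℕ × ℕ)} {L : Finset ℕ}
    (hL : ∀ d ∈ L, IsInteresting θ P F L d) (hm : ∀ d ∈ L, ¬ IsMaximal θ P F L d) : L = ∅ := by
  by_contra hne
  have hne := Finset.nonempty_iff_ne_empty.2 hne
  refine hm _ (L.max'_mem hne) ⟨hL _ (L.max'_mem hne), ?_⟩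
  rintro ⟨j, hj, ⟨hlt, -⟩, -⟩
  exact absurd (L.le_max' j hj) (by omega)

theorem ruleD_le (L : Finset ℕ) (d l : ℕ) (P : ℕ → ℕ) (j : ℕ) : ruleD L d l P j ≤ P j := by
  unfold ruleD; split_ifs <;> simp

theorem ruleR_le (L : Finset ℕ) (d l : ℕ) (P : ℕ → ℕ) (j : ℕ) : ruleR L d l P j ≤ P j := by
  unfold ruleR; split_ifs <;> simp

theorem ruleD_of_notMem {L : Finset ℕ} (d l : ℕ) (P : ℕ → ℕ) {j : ℕ} (hj : j ∉ L) :
    ruleD L d l P j = P j := by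
  simp [ruleD, hj]

theorem ruleR_of_notMem {L : Finset ℕ} (d l : ℕ) (P : ℕ → ℕ) {j : ℕ} (hj : j ∉ L) :
    ruleR L d l P j = P j := by
  simp [ruleR, hj]

/-- Along consecutive interesting peaks that are not maximal, the values of `P` increase. -/
theorem lt_of_forall_not_isMaximal {θ : ℕ} {P : ℕ → ℕ} {F : Finset (ℕ × ℕ)} {a n q : ℕ}
    (hq : IsInteresting θ P F (Finset.Ico a n) q) (hqn : q < n) {d : ℕ} (had : a ≤ d)
    (hdq : d < q) (hd : IsInteresting θ P F (Finset.Ico a n) d)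
    (hmax : ∀ j, d ≤ j → j < q → ¬ IsMaximal θ P F (Finset.Ico a n) j) : P d < P q := by
  obtain ⟨m, hm⟩ : ∃ m, q - d = m := ⟨_, rfl⟩
  induction m using Nat.strong_induction_on generalizing d with
  | _ m ih =>
    have hnot := hmax d le_rfl hdq
    simp only [IsMaximal, hd, true_and, not_not] at hnot
    obtain ⟨k, -, ⟨hdk, hkd⟩, hk⟩ := hnot
    have hlt : ∀ x, d < x → x < d + P d → IsInteresting θ P F (Finset.Ico a n) x → P d < P x := by
      intro x hx hx' hxi
      by_contra! hle
      exact hxi.2 ⟨d, Finset.mem_Ico.2 ⟨had, by omega⟩, ⟨hx, hx'⟩, hle⟩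
    rcases lt_or_ge k q with hkq | hkq
    · exact (hlt k hdk hkd hk).trans
        (ih (q - k) (by omega) (by omega) hkq hk (fun j hj => hmax j (by omega)) rfl)
    -- Here the peak `k` witnessing non-maximality lies at or beyond `q`, so `q` itself is within
    -- the reach of `d`.
    · exact hlt q hdq (by omega) hq

/-- The invariant of the scan. -/
structure ScanInvariant (P₀ : ℕ → ℕ) (n θ : ℕ) (s : State) : Prop where
  P_eq : ∀ j, s.start ≤ j → s.P j = P₀ j
  end_le : ∀ f ∈ s.F, f.1 + f.2 ≤ s.start
  start_le : s.start ≤ s.pos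
  mem_Ico : ∀ d ∈ s.L, s.start ≤ d ∧ d < s.pos
  isInteresting : ∀ d ∈ s.L, IsInteresting θ s.P s.F (s.rest n) d
  not_isMaximal : ∀ d, s.start ≤ d → d < s.pos → ¬ IsMaximal θ s.P s.F (s.rest n) d

/-- A set of positions of the kind that the scan collects: `P₀` takes distinct values on it, all of
them at least `θ`, and at all but one of its elements `P₀` increases. -/
def IsChain (P₀ : ℕ → ℕ) (n θ : ℕ) (A : Finset ℕ) : Prop :=
  Set.InjOn P₀ A ∧ ∃ a, ∀ d ∈ A, d < n ∧ θ ≤ P₀ d ∧ (d = a ∨ 0 < d ∧ P₀ (d - 1) < P₀ d)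

theorem IsChain.subset {P₀ : ℕ → ℕ} {n θ : ℕ} {A B : Finset ℕ} (hBA : B ⊆ A)
    (h : IsChain P₀ n θ A) : IsChain P₀ n θ B :=
  ⟨h.1.mono (by exact_mod_cast hBA), h.2.imp fun _ ha d hd => ha d (hBA hd)⟩

/-- The invariant of the processing of the list. -/
structure ProcessInvariant (P₀ : ℕ → ℕ) (n θ : ℕ) (s : State) : Prop where
  P_eq : ∀ j, s.pos ≤ j → s.P j = P₀ j
  end_le : ∀ f ∈ s.F, f.1 + f.2 ≤ s.pos + s.P s.pos
  lt_pos : ∀ d ∈ s.L, d < s.pos ∧ s.P d ≤ s.P s.pos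
  isInteresting : ∀ d ∈ s.L, IsInteresting θ s.P s.F s.L d
  isChain : IsChain P₀ n θ s.L

/-- The invariant of the algorithm. -/
def Invariant (P₀ : ℕ → ℕ) (n θ : ℕ) (s : State) : Prop :=
  match s.phase with
  | Phase.scan => ScanInvariant P₀ n θ s
  | Phase.process => ProcessInvariant P₀ n θ s

variable {P₀ : ℕ → ℕ} {n θ : ℕ} {s s' : State}

theorem ScanInvariant.isChain (h : ScanInvariant P₀ n θ s) (hθ : 0 < θ)
    (hP₀ : ∀ j, n ≤ j → P₀ j = 0) : IsChain P₀ n θ s.L := by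
  have hlt : ∀ d ∈ s.L, d < n := by
    intro d hd
    by_contra! hdn
    have h1 := (h.isInteresting d hd).1.1
    rw [h.P_eq d (h.mem_Ico d hd).1, hP₀ d hdn] at h1
    omega
  have hmono : ∀ d ∈ s.L, ∀ e ∈ s.L, d < e → P₀ d < P₀ e := by
    intro d hd e he hde
    have hd' := h.mem_Ico d hd
    have he' := h.mem_Ico e he
    rw [← h.P_eq d hd'.1, ← h.P_eq e he'.1]
    exact lt_of_forall_not_isMaximal (h.isInteresting e he) (hlt e he) hd'.1 hde
      (h.isInteresting d hd) fun j hj hj' => h.not_isMaximal j (by omega) (by omega)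
  -- Only at `s.start` can a peak be due to text position `0`, to the end of a factor, or to a
  -- comparison with a possibly rewritten value on its left.
  refine ⟨fun d hd e he hde => ?_, s.start, fun d hd => ⟨hlt d hd, ?_, ?_⟩⟩
  · rcases lt_trichotomy d e with hlt | heq | hgt
    · exact absurd hde (hmono d hd e he hlt).ne
    · exact heq
    · exact absurd hde (hmono e he d hd hgt).ne'
  · rw [← h.P_eq d (h.mem_Ico d hd).1]
    exact (h.isInteresting d hd).1.1
  · have hd' := h.mem_Ico d hd
    rcases (h.isInteresting d hd).1.2 with h0 | hlt | ⟨f, hf, hfd⟩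
    · left; omega
    · by_cases heq : d = s.start
      · exact Or.inl heq
      · rw [h.P_eq d hd'.1, h.P_eq (d - 1) (by omega)] at hlt
        exact Or.inr ⟨by omega, hlt⟩
    · have := h.end_le f hf
      left; omega

theorem Invariant.isChain (h : Invariant P₀ n θ s) (hθ : 0 < θ)
    (hP₀ : ∀ j, n ≤ j → P₀ j = 0) : IsChain P₀ n θ s.L := by
  unfold Invariant at h
  split at h
  · exact ScanInvariant.isChain h hθ hP₀
  · exact ProcessInvariant.isChain h

theorem ScanInvariant.skip (h : ScanInvariant P₀ n θ s)
    (hd : ¬ IsInteresting θ s.P s.F (s.rest n) s.pos) :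
    ScanInvariant P₀ n θ { s with pos := s.pos + 1 } where
  P_eq := h.P_eq
  end_le := h.end_le
  start_le := h.start_le.trans (Nat.le_succ _)
  mem_Ico d hd := ⟨(h.mem_Ico d hd).1, (h.mem_Ico d hd).2.trans (Nat.lt_succ_self _)⟩
  isInteresting := h.isInteresting
  not_isMaximal d hsd hdp := by
    rcases Nat.lt_succ_iff_lt_or_eq.1 hdp with hlt | rfl
    · exact h.not_isMaximal d hsd hlt
    · exact fun hm => hd hm.1

theorem ScanInvariant.insert (h : ScanInvariant P₀ n θ s)
    (hd : IsInteresting θ s.P s.F (s.rest n) s.pos)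
    (hm : ¬ IsMaximal θ s.P s.F (s.rest n) s.pos) :
    ScanInvariant P₀ n θ { s with pos := s.pos + 1, L := Insert.insert s.pos s.L } where
  P_eq := h.P_eq
  end_le := h.end_le
  start_le := h.start_le.trans (Nat.le_succ _)
  mem_Ico d hd := by
    rcases Finset.mem_insert.1 hd with rfl | hd
    · exact ⟨h.start_le, Nat.lt_succ_self _⟩
    · exact ⟨(h.mem_Ico d hd).1, (h.mem_Ico d hd).2.trans (Nat.lt_succ_self _)⟩
  isInteresting e he := by
    rcases Finset.mem_insert.1 he with rfl | he
    · exact hd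
    · exact h.isInteresting e he
  not_isMaximal d hsd hdp := by
    rcases Nat.lt_succ_iff_lt_or_eq.1 hdp with hlt | rfl
    · exact h.not_isMaximal d hsd hlt
    · exact hm

theorem ScanInvariant.factor (h : ScanInvariant P₀ n θ s) (hn : s.pos < n) (hθ : 0 < θ)
    (hP₀ : ∀ j, n ≤ j → P₀ j = 0) (hm : IsMaximal θ s.P s.F (s.rest n) s.pos)
    {P' : ℕ → ℕ} (hP : P' = ruleD s.L s.pos (s.P s.pos) s.P)
    {F' : Finset (ℕ × ℕ)} (hF : F' = Insert.insert (s.pos, s.P s.pos) s.F) :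
    ProcessInvariant P₀ n θ { s with
      phase := Phase.process, P := P', F := F', L := keepInteresting θ P' F' s.L } := by
  have hnot : ∀ j, s.pos ≤ j → j ∉ s.L := fun j hj hjL => by
    have := h.mem_Ico j hjL; omega
  have hpos : P' s.pos = s.P s.pos := by rw [hP, ruleD_of_notMem _ _ _ (hnot _ le_rfl)]
  refine ⟨fun j hj => ?_, fun f hf => ?_, fun d hd => ?_,
    fun d hd => isInteresting_of_mem_keepInteresting hd,
    (h.isChain hθ hP₀).subset keepInteresting_subset⟩
  · have hj : s.pos ≤ j := hj
    simp only [hP, ruleD_of_notMem _ _ _ (hnot j hj)]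
    exact h.P_eq j (h.start_le.trans hj)
  · have hf : f ∈ F' := hf
    simp only [hpos]
    rw [hF] at hf
    rcases Finset.mem_insert.1 hf with rfl | hf
    · exact le_rfl
    · have := h.end_le f hf
      have := h.start_le
      omega
  · have hd := keepInteresting_subset hd
    have hd' := h.mem_Ico d hd
    refine ⟨hd'.2, ?_⟩
    simp only [hpos]
    refine (hP ▸ ruleD_le _ _ _ _ d : P' d ≤ s.P d).trans (le_of_lt ?_)
    -- The maximal peak just found continues the increasing sequence, so its value dominates the
    -- whole list.
    exact lt_of_forall_not_isMaximal hm.1 hn hd'.1 hd'.2 (h.isInteresting d hd)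
      fun j hj hj' => h.not_isMaximal j (by omega) hj'

theorem ProcessInvariant.loop (h : ProcessInvariant P₀ n θ s) {j : ℕ} (hj : j ∈ s.L)
    {P' : ℕ → ℕ} (hP : P' = ruleR s.L j (s.P j) (ruleD s.L j (s.P j) s.P))
    {F' : Finset (ℕ × ℕ)} (hF : F' = Insert.insert (j, s.P j) s.F) :
    ProcessInvariant P₀ n θ { s with P := P', F := F', L := keepInteresting θ P' F' s.L } := by
  have hnot : ∀ i, s.pos ≤ i → i ∉ s.L := fun i hi hiL => by
    have := h.lt_pos i hiL; omega
  have heq : ∀ i, s.pos ≤ i → P' i = s.P i := fun i hi => by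
    rw [hP, ruleR_of_notMem _ _ _ (hnot i hi), ruleD_of_notMem _ _ _ (hnot i hi)]
  refine ⟨fun i hi => (heq i hi).trans (h.P_eq i hi), fun f hf => ?_, fun d hd => ?_,
    fun d hd => isInteresting_of_mem_keepInteresting hd,
    h.isChain.subset keepInteresting_subset⟩
  · have hf : f ∈ F' := hf
    simp only [heq _ le_rfl]
    rw [hF] at hf
    rcases Finset.mem_insert.1 hf with rfl | hf
    -- A factor at `j` starts further left than the scan's factor and is no longer, so it cannot end
    -- behind it. Hence no factor ends beyond the restart position.
    · have := h.lt_pos j hj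
      dsimp only
      omega
    · exact h.end_le f hf
  · have hd' := h.lt_pos d (keepInteresting_subset hd)
    refine ⟨hd'.1, ?_⟩
    simp only [heq _ le_rfl]
    exact (hP ▸ (ruleR_le _ _ _ _ d).trans (ruleD_le _ _ _ _ d) : P' d ≤ s.P d).trans hd'.2

/-- The scan restarts as on a fresh text: the list is empty, and the rules have rewritten values
only to the left of the scan's factor. -/
theorem ProcessInvariant.resume (h : ProcessInvariant P₀ n θ s)
    (hm : ∀ k ∈ s.L, ¬ IsMaximal θ s.P s.F s.L k) :
    ScanInvariant P₀ n θ { s with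
      phase := Phase.scan, pos := s.pos + s.P s.pos, start := s.pos + s.P s.pos } := by
  have hL : s.L = ∅ := eq_empty_of_forall_not_isMaximal h.isInteresting hm
  refine ⟨fun j hj => h.P_eq j (le_of_add_le_left hj), h.end_le, le_rfl, ?_, ?_,
    fun d hd hd' => absurd hd' (not_lt.2 hd)⟩
  all_goals simp [hL]

theorem invariant_iff_of_scan (hs : s.phase = Phase.scan) :
    Invariant P₀ n θ s ↔ ScanInvariant P₀ n θ s := by
  simp only [Invariant, hs]

theorem invariant_iff_of_process (hs : s.phase = Phase.process) :
    Invariant P₀ n θ s ↔ ProcessInvariant P₀ n θ s := by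
  simp only [Invariant, hs]

theorem Invariant.step (hθ : 0 < θ) (hP₀ : ∀ j, n ≤ j → P₀ j = 0) (h : Invariant P₀ n θ s)
    (hstep : Step n θ s s') : Invariant P₀ n θ s' := by
  cases hstep with
  | skip hs hn hd =>
    exact (invariant_iff_of_scan (by exact hs)).2 (((invariant_iff_of_scan hs).1 h).skip hd)
  | insert hs hn hd hm =>
    exact (invariant_iff_of_scan (by exact hs)).2 (((invariant_iff_of_scan hs).1 h).insert hd hm)
  | factor hs hn hm P' hP F' hF =>
    exact (invariant_iff_of_process rfl).2
      (((invariant_iff_of_scan hs).1 h).factor hn hθ hP₀ hm hP hF)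
  | loop hs j hj hm hright P' hP F' hF =>
    exact (invariant_iff_of_process (by exact hs)).2
      (((invariant_iff_of_process hs).1 h).loop hj hP hF)
  | resume hs hm =>
    exact (invariant_iff_of_scan rfl).2 (((invariant_iff_of_process hs).1 h).resume hm)

theorem invariant_init {α : Type u} [LinearOrder α] (T : List α) (n θ : ℕ) :
    Invariant (PLCP T) n θ (init T) :=
  show ScanInvariant _ _ _ _ from
    ⟨fun _ _ => rfl, by simp [init], le_rfl, by simp [init], by simp [init], by simp [init]⟩

theorem Reachable.isChain {α : Type u} [LinearOrder α] {T : List α} (hθ : 0 < θ)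
    (h : Reachable T θ s) : IsChain (PLCP T) T.length θ s.L := by
  have hP₀ : ∀ j, T.length ≤ j → PLCP T j = 0 := fun j hj => by
    simp [PLCP, not_lt.2 hj]
  refine Invariant.isChain ?_ hθ hP₀
  induction h with
  | refl => exact invariant_init T _ θ
  | tail _ hstep ih => exact ih.step hθ hP₀ hstep

end Algorithm

/-! ### From chains to the two bounds. -/

section Bound

theorem sq_card_le_two_mul_sum {s : Finset ℕ} (hs : ∀ x ∈ s, 0 < x) :
    s.card ^ 2 ≤ 2 * ∑ x ∈ s, x := by
  induction s using Finset.induction_on_max with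
  | empty => simp
  | insert a s ha ih =>
    have hnot : a ∉ s := fun h => lt_irrefl _ (ha a h)
    have hcard : s.card ≤ a - 1 := by
      rw [← Nat.card_Ico 1 a]
      exact Finset.card_le_card fun x hx =>
        Finset.mem_Ico.2 ⟨hs x (Finset.mem_insert_of_mem hx), ha x hx⟩
    have ha0 := hs a (Finset.mem_insert_self _ _)
    have ih := ih fun x hx => hs x (Finset.mem_insert_of_mem hx)
    rw [Finset.card_insert_of_notMem hnot, Finset.sum_insert hnot]
    -- A new maximum is at least the new cardinality `m + 1`, and `(m + 1)² ≤ m² + 2 (m + 1)`.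
    have : s.card + 1 ≤ a := by omega
    nlinarith

variable {α : Type u} [LinearOrder α] {T : List α} {θ : ℕ} {L : Finset ℕ}

theorem PLCP_SA (k : Fin T.length) : PLCP T (SA T k) = LCP T k := by
  simp [PLCP, ISA]

theorem two_le_length_of_PLCP_pos {d : ℕ} (h : 0 < PLCP T d) : 2 ≤ T.length := by
  unfold PLCP at h
  split_ifs at h with hd
  · have hk : (ISA T ⟨d, hd⟩).val ≠ 0 := fun h0 => by simp [LCP, h0] at h
    have := (ISA T ⟨d, hd⟩).isLt
    omega
  · omega

open Classical in
theorem IsChain.exists_erase_subset (h : IsChain (PLCP T) T.length θ L) :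
    ∃ a, L.erase a ⊆
      (Finset.univ.filter (IsIrreducible T)).image fun k => (SA T k).val := by
  obtain ⟨-, a, ha⟩ := h
  refine ⟨a, fun d hd => ?_⟩
  obtain ⟨hda, hd⟩ := Finset.mem_erase.1 hd
  obtain ⟨hdn, -, hor⟩ := ha d hd
  obtain ⟨hd0, hlt⟩ := hor.resolve_left hda
  obtain ⟨e, rfl⟩ := Nat.exists_eq_succ_of_ne_zero hd0.ne'
  exact Finset.mem_image.2 ⟨ISA T ⟨e + 1, hdn⟩,
    Finset.mem_filter.2 ⟨Finset.mem_univ _, isIrreducible_of_PLCP_lt hdn hlt⟩, by simp [ISA]⟩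

theorem IsChain.card_le_bwtRuns (hT : EndsWithSentinel T)
    (h : IsChain (PLCP T) T.length θ L) : L.card ≤ bwtRuns T := by
  classical
  obtain ⟨a, ha⟩ := h.exists_erase_subset
  have h1 := (Finset.card_le_card ha).trans Finset.card_image_le
  have h2 := Finset.pred_card_le_card_erase (s := L) (a := a)
  have h3 := card_isIrreducible_le_bwtRuns hT
  omega

/-- Without the exceptional element, the values are distinct, positive and irreducible, so the lower
and the upper bound on their sum can be compared. -/
theorem IsChain.sq_card_le (hθ : 0 < θ) (h : IsChain (PLCP T) T.length θ L) :
    (L.card - 1) ^ 2 ≤ 4 * (T.length * Nat.log 2 T.length) := by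
  classical
  obtain ⟨a, ha⟩ := h.exists_erase_subset
  obtain ⟨hinj, b, hb⟩ := h
  have hinj' : Set.InjOn (PLCP T) (L.erase a) :=
    hinj.mono (by exact_mod_cast Finset.erase_subset a L)
  have h1 : ∑ d ∈ L.erase a, PLCP T d ≤ 2 * (T.length * Nat.log 2 T.length) := by
    refine (Finset.sum_le_sum_of_subset ha).trans ?_
    rw [Finset.sum_image fun k _ l _ hkl => (SA T).injective (Fin.ext hkl)]
    simp only [PLCP_SA]
    exact sum_LCP_isIrreducible_le T
  have h2 := sq_card_le_two_mul_sum (s := (L.erase a).image (PLCP T)) (by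
    intro x hx
    obtain ⟨d, hd, rfl⟩ := Finset.mem_image.1 hx
    exact hθ.trans_le (hb d (Finset.mem_of_mem_erase hd)).2.1)
  rw [Finset.card_image_of_injOn hinj', Finset.sum_image hinj'] at h2
  have h3 := Nat.pow_le_pow_left (Finset.pred_card_le_card_erase (s := L) (a := a)) 2
  omega

theorem IsChain.card_le_sqrt (hθ : 0 < θ) (h : IsChain (PLCP T) T.length θ L) :
    (L.card : ℝ) ≤ 3 * Real.sqrt ((T.length : ℝ) * Real.logb 2 (T.length : ℝ)) := by
  rcases L.eq_empty_or_nonempty with rfl | ⟨d, hd⟩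
  · simp only [Finset.card_empty, Nat.cast_zero]; positivity
  obtain ⟨-, b, hb⟩ := id h
  have hn : 2 ≤ T.length := two_le_length_of_PLCP_pos (hθ.trans_le (hb d hd).2.1)
  have hpos : 1 ≤ L.card := Finset.card_pos.2 ⟨d, hd⟩
  set X := (T.length : ℝ) * Real.logb 2 (T.length : ℝ) with hX
  have hlog : (Nat.log 2 T.length : ℝ) ≤ Real.logb 2 T.length := by
    exact_mod_cast Real.natLog_le_logb T.length 2
  have hlog1 : (1 : ℝ) ≤ Nat.log 2 T.length := by
    exact_mod_cast Nat.log_pos one_lt_two hn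
  have hn' : (2 : ℝ) ≤ T.length := by exact_mod_cast hn
  -- A nonempty list forces `n ≥ 2`, so `1 ≤ √X`; this absorbs the exceptional element and turns the
  -- constant `2` into `3`.
  have hX1 : 1 ≤ X := by nlinarith
  have hsqrt : 1 ≤ Real.sqrt X := Real.one_le_sqrt.2 hX1
  have hsq : ((L.card : ℝ) - 1) ^ 2 ≤ 4 * X := by
    have h1 : ((L.card - 1 : ℕ) : ℝ) ^ 2 ≤ 4 * (T.length * Nat.log 2 T.length) := by
      exact_mod_cast h.sq_card_le hθ
    rw [Nat.cast_sub hpos, Nat.cast_one] at h1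
    refine h1.trans ?_
    rw [hX]
    gcongr
  have h4 : (L.card : ℝ) - 1 ≤ 2 * Real.sqrt X := by
    refine le_of_sq_le_sq ?_ (by positivity)
    rw [mul_pow, Real.sq_sqrt (by positivity)]
    linarith
  linarith

end Bound

end Plcpcomp

theorem mainTheorem3 :
    ∃ C : ℝ, 0 < C ∧
      ∀ (α : Type u) [LinearOrder α] (T : List α) (θ : ℕ),
        Plcpcomp.EndsWithSentinel T → 2 ≤ θ →
        ∀ s : Plcpcomp.State, Plcpcomp.Reachable T θ s →
          (s.L.card : ℝ) ≤
            C * min (Real.sqrt ((T.length : ℝ) * Real.logb 2 (T.length : ℝ)))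
              (Plcpcomp.bwtRuns T : ℝ) := by
  refine ⟨3, by norm_num, fun α _ T θ hT hθ s hs => ?_⟩
  have hθ0 : 0 < θ := by omega
  have hchain := hs.isChain hθ0
  rw [mul_min_of_nonneg _ _ (by norm_num), le_min_iff]
  refine ⟨hchain.card_le_sqrt hθ0, ?_⟩
  have h1 : (s.L.card : ℝ) ≤ Plcpcomp.bwtRuns T := by exact_mod_cast hchain.card_le_bwtRuns hT
  have h2 : (0 : ℝ) ≤ Plcpcomp.bwtRuns T := Nat.cast_nonneg _
  linarith
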